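/- Let $\mathbb{F}$ be an arbitrary (possibly finite) field and let $n\ge 2$. Let $\mathrm{GL}_n=\mathrm{GL}_n(\mathbb{F})$ act on pairs of $n\times n$ matrices over $\mathbb{F}$ by simultaneous conjugation, $g\cdot(A_1,A_2)=(gA_1g^{-1},gA_2g^{-1})$, and let $D_n$ be the set of all pairs $\underline{A}=(A_1,A_2)$ such that $A_1$ has $n$ distinct eigenvalues in $\mathbb{F}$. Let $X_k=(x_{ij}(k))_{1\le i,j\le n}$, $k=1,2$, be the generic $n\times n$ matrices over the polynomial ring $\mathbb{F}[x_{ij}(k)]$, and let $\mathcal{X}_2$ be the unital associative $\mathbb{F}$-algebra generated by $X_1,X_2$. The degree $\deg F$ of $F\in\mathcal{X}_2$ is the minimal degree of a noncommutative polynomial $f$ over $\mathbb{F}$ in two letters with $F=f(X_1,X_2)$, and $F(\underline{A})$ is the matrix obtained from $F$ by replacing each $x_{ij}(k)$ by the $(i,j)$ entry of $A_k$. Then the $\mathrm{GL}_n$-orbits on $D_n$ are separated by the set $$\{\operatorname{rank}(F)\mid F\in\mathcal{X}_2,\ \deg F\le (n+1)(2n-1)\},$$ that is, if $\underline{A},\underline{B}\in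 D_n$ satisfy $\operatorname{rank}F(\underline{A})=\operatorname{rank}F(\underline{B})$ for all $F\in\mathcal{X}_2$ with $\deg F\le(n+1)(2n-1)$, then $\mathrm{GL}_n\cdot\underline{A}=\mathrm{GL}_n\cdot\underline{B}$. Moreover, the two-sided Curto--Herrero conjecture holds on $D_n$: for all $\underline{A},\underline{B}\in D_n$, one has $\mathrm{GL}_n\cdot\underline{A}=\mathrm{GL}_n\cdot\underline{B}$ if and only if $\operatorname{rank}f(\underline{A})=\operatorname{rank}f(\underline{B})$ for every noncommutative polynomial $f$ over $\mathbb{F}$ in two letters (possibly with a free term). -/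

import Mathlib

noncomputable section

namespace MatrixTuples

/-- The space `M_n^m` of `m`-tuples of `n × n` matrices over `F`. The matrices `A_1, …, A_m` of a
tuple `A` are `A 0, …, A (m - 1)`. -/
abbrev Tuple (F : Type*) (n m : ℕ) : Type _ := Fin m → Matrix (Fin n) (Fin n) F

/-- The `GL_n`-orbit of a tuple under simultaneous conjugation
`g · (A_1, …, A_m) = (g A_1 g⁻¹, …, g A_m g⁻¹)`. -/
def orbit {F : Type*} [Field F] {n m : ℕ} (A : Tuple F n m) : Set (Tuple F n m) :=
  Set.range fun (g : Matrix.GeneralLinearGroup (Fin n) F) (k : Fin m) =>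
    (g : Matrix (Fin n) (Fin n) F) * A k * ((g⁻¹ : Matrix.GeneralLinearGroup (Fin n) F) :
      Matrix (Fin n) (Fin n) F)

/-- The set `D_n` of pairs `(A_1, A_2)` such that `A_1` has `n` distinct eigenvalues in `F`. -/
def simpleSpectrumPairs (F : Type*) [Field F] (n : ℕ) : Set (Tuple F n 2) :=
  {A | ∃ a : Fin n → F, Function.Injective a ∧
    ∀ i, Module.End.HasEigenvalue (Matrix.toLin' (A 0)) (a i)}

/-- The coordinate algebra `F[x_{ij}(k)]` of `M_n^m`; the variable `x_{ij}(k)` has index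
`(k, i, j)`. -/
abbrev CoordAlgebra (F : Type*) [Field F] (n m : ℕ) : Type _ :=
  MvPolynomial (Fin m × Fin n × Fin n) F

/-- The generic matrix `X_k = (x_{ij}(k))`. -/
def genericMatrix (F : Type*) [Field F] (n m : ℕ) (k : Fin m) :
    Matrix (Fin n) (Fin n) (CoordAlgebra F n m) :=
  Matrix.of fun i j => MvPolynomial.X (k, i, j)

/-- The unital associative `F`-algebra generated by the generic matrices `X_1, …, X_m`. -/
def genericAlgebra (F : Type*) [Field F] (n m : ℕ) :
    Subalgebra F (Matrix (Fin n) (Fin n) (CoordAlgebra F n m)) :=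
  Algebra.adjoin F (Set.range (genericMatrix F n m))

/-- The degree of a noncommutative polynomial: the largest length of a word that occurs in it with
a nonzero coefficient (and `0` for the zero polynomial). -/
def ncDegree {F : Type*} [Field F] {m : ℕ} (f : FreeAlgebra F (Fin m)) : ℕ :=
  (FreeAlgebra.equivMonoidAlgebraFreeMonoid f).coeff.support.sup FreeMonoid.length

/-- The degree of an element `P` of the algebra of generic matrices: the minimal degree of a
noncommutative polynomial `f` with `P = f(X_1, …, X_m)`. -/
def genericDegree {F : Type*} [Field F] {n m : ℕ} (P : genericAlgebra F n m) : ℕ :=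
  sInf {d | ∃ f : FreeAlgebra F (Fin m),
    FreeAlgebra.lift F (genericMatrix F n m) f =
      (P : Matrix (Fin n) (Fin n) (CoordAlgebra F n m)) ∧ ncDegree f = d}

/-- The minimum defining `genericDegree` is attained. -/
theorem exists_ncDegree_eq_genericDegree {F : Type*} [Field F] {n m : ℕ}
    (P : genericAlgebra F n m) :
    ∃ f : FreeAlgebra F (Fin m),
      FreeAlgebra.lift F (genericMatrix F n m) f =
        (P : Matrix (Fin n) (Fin n) (CoordAlgebra F n m)) ∧ ncDegree f = genericDegree P := by
  have hP : (P : Matrix (Fin n) (Fin n) (CoordAlgebra F n m)) ∈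
    Algebra.adjoin F (Set.range (genericMatrix F n m)) := P.2
  rw [Algebra.adjoin_range_eq_range_freeAlgebra_lift] at hP
  obtain ⟨f, hf⟩ := hP
  exact Nat.sInf_mem (s := {d | ∃ f : FreeAlgebra F (Fin m),
    FreeAlgebra.lift F (genericMatrix F n m) f =
      (P : Matrix (Fin n) (Fin n) (CoordAlgebra F n m)) ∧ ncDegree f = d}) ⟨_, f, hf, rfl⟩

/-- The value `P(A)` of an element `P` of the algebra of generic matrices at a tuple `A`:
`x_{ij}(k)` is replaced by the `(i, j)` entry of `A_k`. -/
def evalAt {F : Type*} [Field F] {n m : ℕ} (P : genericAlgebra F n m) (A : Tuple F n m) :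
    Matrix (Fin n) (Fin n) F :=
  (P : Matrix (Fin n) (Fin n) (CoordAlgebra F n m)).map
    (MvPolynomial.eval fun x => A x.1 x.2.1 x.2.2)

/-- The set of functions `A ↦ rank P(A)` on `M_n^m`, where `P` runs over the elements of degree at
most `d` of the algebra of generic matrices. -/
def rankFunctions (F : Type*) [Field F] (n m d : ℕ) : Set (Tuple F n m → ℕ) :=
  {r | ∃ P : genericAlgebra F n m, genericDegree P ≤ d ∧ r = fun A => (evalAt P A).rank}

/-- A set `S` of functions on `M_n^m` separates the `GL_n`-orbits on `L`. -/
def SeparatesOrbitsOn {F : Type*} [Field F] {n m : ℕ} (L : Set (Tuple F n m))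
    (S : Set (Tuple F n m → ℕ)) : Prop :=
  ∀ A ∈ L, ∀ B ∈ L, (∀ r ∈ S, r A = r B) → orbit A = orbit B

end MatrixTuples

end

/-! The ranks of `X₁ - μ` determine the spectrum of `A₁`, so both pairs can be conjugated to have
the same first matrix `diag a`. The Lagrange idempotents of `X₁` then become the matrix units
`E_ii`, and the combinations of `E_ii X₂ E_jj` and `E_ii` realise every `C ⊙ A₂ + diag d` in degree
at most `2n - 1`. Ranks of these give the diagonal of `A₂`, and after replacing that diagonal by
ones, the ranks of all Hadamard multiples.

The core is `exists_scaling_of_rank_hadamard_eq`: such ranks determine a matrix up to row and column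
scaling. The scaling is built edge by edge on the bipartite graph of nonzero entries. An edge
joining two components is matched by rescaling one of them; an edge closing a cycle is controlled by
a rank that drops only for the right value. The diagonal ones make the two scalings mutually
inverse, so the scaling is a conjugation fixing `diag a`. -/

namespace MatrixTuples

/-! ### Ranks of Hadamard multiples and scaling of rows and columns -/

section Hadamard

variable {F I J : Type*} [Field F]

/-- `AlternatingChain T x₀ R y`: there is a walk `x₀, y₁, x₁, …, y` in the bipartite graph with edge
relation `T` whose row vertices are pairwise distinct and form the set `R`. -/
inductive AlternatingChain [DecidableEq I] (T : I → J → Prop) (x₀ : I) : Finset I → J → Prop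
  | base {y : J} : T x₀ y → AlternatingChain T x₀ {x₀} y
  | step {R : Finset I} {y z : J} {x : I} : AlternatingChain T x₀ R y → x ∉ R → T x y → T x z →
      AlternatingChain T x₀ (insert x R) z

namespace AlternatingChain

variable [DecidableEq I] {T : I → J → Prop} {x₀ : I}

/-- The chain is cut at its visit to `x` and leaves `x` towards `z` instead; this keeps its rows
distinct. -/
theorem shortcut {R : Finset I} {y : J} (h : AlternatingChain T x₀ R y) {x : I} (hx : x ∈ R)
    {z : J} (hz : T x z) : ∃ R', AlternatingChain T x₀ R' z := by
  induction h with
  | base _ =>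
    rw [Finset.mem_singleton] at hx
    subst hx
    exact ⟨_, base hz⟩
  | step h₁ h₂ h₃ _ ih =>
    rcases Finset.mem_insert.1 hx with rfl | hx
    · exact ⟨_, step h₁ h₂ h₃ hz⟩
    · exact ih hx

theorem exists_extend {R : Finset I} {y : J} (h : AlternatingChain T x₀ R y) {x : I} (hy : T x y)
    {z : J} (hz : T x z) : ∃ R', AlternatingChain T x₀ R' z := by
  by_cases hx : x ∈ R
  · exact h.shortcut hx hz
  · exact ⟨_, step h hx hy hz⟩

/-- A chain ending in `y` yields a matrix `C` supported on its edges and a set `Y` of columns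
containing `y` such that the solutions of `C w = c e_{x₀}` are constant equal to `c` on `Y`. -/
theorem exists_matrix [Fintype J] [DecidableEq J] {R : Finset I} {y : J}
    (h : AlternatingChain T x₀ R y) :
    ∃ (C : Matrix I J F) (Y : Finset J), y ∈ Y ∧ (∀ i j, C i j ≠ 0 → T i j ∧ i ∈ R ∧ j ∈ Y) ∧
      C.mulVec (fun j => if j ∈ Y then 1 else 0) = Pi.single x₀ 1 ∧
      ∀ (w : J → F) (c : F), C.mulVec w = Pi.single x₀ c → ∀ j ∈ Y, w j = c := by
  induction h with
  | @base y hy =>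
    refine ⟨Matrix.single x₀ y 1, {y}, Finset.mem_singleton_self y, ?_, ?_, ?_⟩
    · intro i j hij
      have : x₀ = i ∧ y = j := by
        by_contra hne
        exact hij (Matrix.single_apply_of_ne _ _ _ _ _ hne)
      obtain ⟨rfl, rfl⟩ := this
      simp [hy]
    · rw [Matrix.single_mulVec]
      simp
      rfl
    · intro w c hw j hj
      rw [Finset.mem_singleton] at hj
      subst hj
      have := congrFun hw x₀
      rw [Matrix.single_mulVec] at this
      simpa using this
  | @step R y z x h₁ hx hy hz ih =>
    obtain ⟨C, Y, hyY, hC, hC₁, hC₂⟩ := ih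
    by_cases hzY : z ∈ Y
    -- No new row is needed: `w z = c` is already forced.
    · refine ⟨C, Y, hzY, fun i j hij => ?_, hC₁, hC₂⟩
      obtain ⟨h₁, h₂, h₃⟩ := hC i j hij
      exact ⟨h₁, Finset.mem_insert_of_mem h₂, h₃⟩
    · have hCx : ∀ j, C x j = 0 := fun j => by
        by_contra hne
        exact hx (hC x j hne).2.1
      have hCz : ∀ i, C i z = 0 := fun i => by
        by_contra hne
        exact hzY (hC i z hne).2.2
      have hx₀ : x ≠ x₀ := by
        rintro rfl
        have := congrFun hC₁ x
        simp [Matrix.mulVec, dotProduct, hCx] at this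
      -- Row `x` of `C` is zero because `x ∉ R`. It becomes `e_z - e_y`, which forces `w z = w y`
      -- and kills the indicator of the enlarged `Y`.
      refine ⟨C + Matrix.single x z 1 - Matrix.single x y 1, insert z Y,
        Finset.mem_insert_self _ _, ?_, ?_, ?_⟩
      · intro i j hij
        by_cases hCij : C i j = 0
        · rw [Matrix.sub_apply, Matrix.add_apply, hCij, Matrix.single_apply,
            Matrix.single_apply] at hij
          by_cases h₁ : x = i ∧ z = j
          · obtain ⟨rfl, rfl⟩ := h₁
            simp [hz]
          · by_cases h₂ : x = i ∧ y = j
            · obtain ⟨rfl, rfl⟩ := h₂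
              simp [hy, hyY]
            · simp [h₁, h₂] at hij
        · obtain ⟨h₁, h₂, h₃⟩ := hC i j hCij
          exact ⟨h₁, Finset.mem_insert_of_mem h₂, Finset.mem_insert_of_mem h₃⟩
      · have hC₁' : C.mulVec (fun j => if j ∈ insert z Y then (1 : F) else 0) =
            Pi.single x₀ 1 := by
          rw [← hC₁]
          ext i
          refine Finset.sum_congr rfl fun j _ => ?_
          by_cases hj : j = z
          · subst hj
            simp [hCz]
          · simp [hj]
        rw [Matrix.sub_mulVec, Matrix.add_mulVec, hC₁', Matrix.single_mulVec,
          Matrix.single_mulVec]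
        simp [hyY]
      · intro w c hw
        rw [Matrix.sub_mulVec, Matrix.add_mulVec, Matrix.single_mulVec,
          Matrix.single_mulVec] at hw
        have hCw : C.mulVec w x = 0 := by simp [Matrix.mulVec, dotProduct, hCx]
        have hwx := congrFun hw x
        simp [hCw, hx₀] at hwx
        have hzy : w z = w y := sub_eq_zero.1 hwx
        have hw' : C.mulVec w = Pi.single x₀ c := by
          rw [← hw, hzy]
          simp
        intro j hj
        rcases Finset.mem_insert.1 hj with rfl | hj
        · rw [hzy]
          exact hC₂ w c hw' y hyY
        · exact hC₂ w c hw' j hj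

end AlternatingChain

theorem rank_eq_zero_iff [Fintype J] [DecidableEq J] {M : Matrix I J F} : M.rank = 0 ↔ M = 0 := by
  rw [Matrix.rank, Submodule.finrank_eq_zero, LinearMap.range_eq_bot]
  refine ⟨fun h => ?_, fun h => by rw [h, Matrix.mulVecLin_zero]⟩
  ext i j
  have := congrFun (LinearMap.congr_fun h (Pi.single j 1)) i
  simpa using this

theorem rank_lt_of_ker_lt [Fintype J] {P Q : Matrix I J F}
    (h : LinearMap.ker P.mulVecLin < LinearMap.ker Q.mulVecLin) : Q.rank < P.rank := by
  have h₁ := LinearMap.finrank_range_add_finrank_ker P.mulVecLin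
  have h₂ := LinearMap.finrank_range_add_finrank_ker Q.mulVecLin
  have h₃ := Submodule.finrank_lt_finrank_of_lt h
  simp only [Matrix.rank]
  omega

theorem eq_zero_iff_of_rank_hadamard_eq [DecidableEq I] [Fintype J] [DecidableEq J]
    {M N : Matrix I J F}
    (hrank : ∀ C : Matrix I J F, (C.hadamard M).rank = (C.hadamard N).rank) (i : I) (j : J) :
    M i j = 0 ↔ N i j = 0 := by
  have key : ∀ M : Matrix I J F, ((Matrix.single i j 1).hadamard M).rank = 0 ↔ M i j = 0 := by
    intro M
    have h : (Matrix.single i j 1).hadamard M = Matrix.single i j (M i j) := by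
      ext a b
      rw [Matrix.hadamard_apply]
      by_cases h : i = a ∧ j = b
      · obtain ⟨rfl, rfl⟩ := h
        simp
      · simp [Matrix.single_apply_of_ne _ _ _ _ _ h]
    rw [h, rank_eq_zero_iff]
    exact ⟨fun h => by simpa using congrFun (congrFun h i) j, fun h => by rw [h, Matrix.single_zero]⟩
  rw [← key M, ← key N, hrank]

variable [Fintype I] [Fintype J] [DecidableEq I] [DecidableEq J]

/-- If `N` arises from `M` by row and column scaling on the entries in `T`, and `y` is joined to
`x` by a chain in `T`, then equal ranks of the Hadamard multiples force the same scaling at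
`(x, y)`. -/
theorem scaling_eq_of_alternatingChain {M N : Matrix I J F}
    (hrank : ∀ C : Matrix I J F, (C.hadamard M).rank = (C.hadamard N).rank)
    {T : I → J → Prop} (hT : ∀ i j, T i j → M i j ≠ 0) {r : I → F} {s : J → F}
    (hr : ∀ i, r i ≠ 0) (hs : ∀ j, s j ≠ 0) (hrs : ∀ i j, T i j → N i j = r i * M i j * s j)
    {x : I} {y : J} (hM : M x y ≠ 0) (hxy : ¬ T x y) {R : Finset I}
    (hR : AlternatingChain T x R y) : N x y = r x * M x y * s y := by
  obtain ⟨C, Y, hyY, hC, hC₁, hC₂⟩ := hR.exists_matrix (F := F)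
  by_contra hne
  set v : F := N x y / (r x * M x y * s y) with hv
  have hden : r x * M x y * s y ≠ 0 := mul_ne_zero (mul_ne_zero (hr x) hM) (hs y)
  have hv₁ : v ≠ 1 := fun h => hne ((div_eq_one_iff_eq hden).1 h)
  have hNv : N x y = v * (r x * M x y * s y) := (div_mul_cancel₀ _ hden).symm
  have hCxy : C x y = 0 := by
    by_contra h
    exact hxy (hC x y h).1
  -- The test matrix turns `M` into `C - E_xy`, and `N` into `C - v E_xy` up to invertible scaling.
  -- Division by zero is harmless: where `M` vanishes, so does the numerator.
  have key := hrank (Matrix.of fun i j => (C i j - Matrix.single x y 1 i j) / M i j)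
  have e₁ : (Matrix.of fun i j => (C i j - Matrix.single x y 1 i j) / M i j).hadamard M =
      C - Matrix.single x y 1 := by
    ext i j
    rw [Matrix.hadamard_apply, Matrix.of_apply]
    by_cases h : M i j = 0
    · have h₁ : C i j = 0 := by
        by_contra h'
        exact hT i j (hC i j h').1 h
      have h₂ : ¬ (x = i ∧ y = j) := by
        rintro ⟨rfl, rfl⟩
        exact hM h
      simp [h, h₁, Matrix.single_apply_of_ne _ _ _ _ _ h₂]
    · exact div_mul_cancel₀ _ h
  have e₂ : (Matrix.of fun i j => (C i j - Matrix.single x y 1 i j) / M i j).hadamard N =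
      Matrix.diagonal r * (C - Matrix.single x y v) * Matrix.diagonal s := by
    ext i j
    rw [Matrix.hadamard_apply, Matrix.of_apply, Matrix.mul_diagonal, Matrix.diagonal_mul]
    by_cases h₂ : x = i ∧ y = j
    · obtain ⟨rfl, rfl⟩ := h₂
      rw [hNv]
      simp [hCxy]
      field_simp
    · rw [Matrix.sub_apply, Matrix.single_apply_of_ne _ _ _ _ _ h₂,
        Matrix.single_apply_of_ne _ _ _ _ _ h₂, sub_zero]
      by_cases h : C i j = 0
      · simp [h]
      · have hTij := (hC i j h).1
        have hMij := hT i j hTij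
        rw [hrs i j hTij]
        field_simp
  rw [e₁, e₂, Matrix.rank_mul_eq_left_of_isUnit_det, Matrix.rank_mul_eq_right_of_isUnit_det] at key
  rotate_left
  · rw [Matrix.det_diagonal]
    exact (Finset.prod_ne_zero_iff.2 fun i _ => hr i).isUnit
  · rw [Matrix.det_diagonal]
    exact (Finset.prod_ne_zero_iff.2 fun i _ => hs i).isUnit
  refine (rank_lt_of_ker_lt (P := C - Matrix.single x y v) (Q := C - Matrix.single x y 1)
    ?_).ne key
  rw [SetLike.lt_iff_le_and_exists]
  -- If `C w = v w_y e_x`, then `w_y = v w_y`, so `w_y = 0` since `v ≠ 1`; hence `w` also lies in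
  -- the other kernel. The indicator of `Y` makes the inclusion strict.
  refine ⟨fun w hw => ?_, fun j => if j ∈ Y then 1 else 0, ?_, ?_⟩
  · rw [LinearMap.mem_ker, Matrix.mulVecLin_apply, Matrix.sub_mulVec, Matrix.single_mulVec,
      sub_eq_zero] at hw
    have hw' : C.mulVec w = Pi.single x (v * w y) := by
      rw [hw]
      rfl
    have h₁ := hC₂ w _ hw'
    have h₂ : w y = 0 := by
      have h₃ : (1 - v) * w y = 0 := by
        rw [sub_mul, one_mul, sub_eq_zero]
        exact h₁ y hyY
      exact (mul_eq_zero.1 h₃).resolve_left (sub_ne_zero.2 hv₁.symm)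
    rw [LinearMap.mem_ker, Matrix.mulVecLin_apply, Matrix.sub_mulVec, hw', Matrix.single_mulVec]
    simp [h₂]
  · rw [LinearMap.mem_ker, Matrix.mulVecLin_apply, Matrix.sub_mulVec, hC₁, Matrix.single_mulVec]
    simp only [hyY, if_true, mul_one]
    exact sub_self _
  · rw [LinearMap.mem_ker, Matrix.mulVecLin_apply, Matrix.sub_mulVec, hC₁, Matrix.single_mulVec]
    intro h
    have := congrFun h x
    simp [hyY] at this
    exact hv₁ (sub_eq_zero.1 this).symm

/-- Induction on the set of edges: a new edge either closes a cycle, where the scaling is forced to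
fit, or joins two components, where one of them can be rescaled. -/
theorem exists_scaling_on_finset {M N : Matrix I J F}
    (hrank : ∀ C : Matrix I J F, (C.hadamard M).rank = (C.hadamard N).rank)
    (hN : ∀ i j, M i j ≠ 0 → N i j ≠ 0) (T : Finset (I × J)) (hT : ∀ p ∈ T, M p.1 p.2 ≠ 0) :
    ∃ (r : I → F) (s : J → F), (∀ i, r i ≠ 0) ∧ (∀ j, s j ≠ 0) ∧
      ∀ i j, (i, j) ∈ T → N i j = r i * M i j * s j := by
  classical
  induction T using Finset.induction_on with
  | empty => exact ⟨1, 1, by simp, by simp, by simp⟩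
  | insert e T he ih =>
    obtain ⟨x, y⟩ := e
    obtain ⟨r, s, hr, hs, hrs⟩ := ih fun p hp => hT p (Finset.mem_insert_of_mem hp)
    have hM : M x y ≠ 0 := hT (x, y) (Finset.mem_insert_self _ _)
    have hT' : ∀ i j, (i, j) ∈ T → M i j ≠ 0 :=
      fun i j hij => hT (i, j) (Finset.mem_insert_of_mem hij)
    set E : I → J → Prop := fun i j => (i, j) ∈ T with hE
    by_cases hreach : ∃ R, AlternatingChain E x R y
    · obtain ⟨R, hR⟩ := hreach
      refine ⟨r, s, hr, hs, fun i j hij => ?_⟩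
      rcases Finset.mem_insert.1 hij with h | h
      · obtain ⟨rfl, rfl⟩ := Prod.mk.inj h
        exact scaling_eq_of_alternatingChain hrank hT' hr hs hrs hM he hR
      · exact hrs i j h
    · set v : F := N x y / (r x * M x y * s y) with hv
      have hden : r x * M x y * s y ≠ 0 := mul_ne_zero (mul_ne_zero (hr x) hM) (hs y)
      have hv₀ : v ≠ 0 := div_ne_zero (hN x y hM) hden
      have hNv : N x y = v * (r x * M x y * s y) := (div_mul_cancel₀ _ hden).symm
      -- `c` and `d` cut out the columns and rows of the component of `x`. Multiplying its rows by
      -- `v` and its columns by `v⁻¹` preserves old edges and corrects the new one, as `y` lies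
      -- outside.
      let c : J → Prop := fun j => ∃ R, AlternatingChain E x R j
      let d : I → Prop := fun i => i = x ∨ ∃ j, c j ∧ E i j
      have hcd : ∀ i j, E i j → (d i ↔ c j) := by
        intro i j hij
        constructor
        · rintro (rfl | ⟨z, ⟨R, hR⟩, hz⟩)
          · exact ⟨_, .base hij⟩
          · exact hR.exists_extend hz hij
        · exact fun h => Or.inr ⟨j, h, hij⟩
      refine ⟨fun i => if d i then v * r i else r i, fun j => if c j then v⁻¹ * s j else s j,
        fun i => ?_, fun j => ?_, fun i j hij => ?_⟩
      · dsimp only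
        split_ifs
        exacts [mul_ne_zero hv₀ (hr i), hr i]
      · dsimp only
        split_ifs
        exacts [mul_ne_zero (inv_ne_zero hv₀) (hs j), hs j]
      · rcases Finset.mem_insert.1 hij with h | h
        · obtain ⟨rfl, rfl⟩ := Prod.mk.inj h
          have h₁ : d i := Or.inl rfl
          have h₂ : ¬ c j := hreach
          simp only [h₁, h₂, if_true, if_false]
          rw [hNv]
          ring
        · rw [hrs i j h]
          by_cases hc : c j
          · simp only [(hcd i j h).2 hc, hc, if_true]
            field_simp
          · simp only [mt (hcd i j h).1 hc, hc, if_false]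

/-- Two matrices all of whose Hadamard multiples have equal ranks differ by an invertible scaling
of rows and columns. -/
theorem exists_scaling_of_rank_hadamard_eq {M N : Matrix I J F}
    (hrank : ∀ C : Matrix I J F, (C.hadamard M).rank = (C.hadamard N).rank) :
    ∃ (r : I → F) (s : J → F), (∀ i, r i ≠ 0) ∧ (∀ j, s j ≠ 0) ∧
      ∀ i j, N i j = r i * M i j * s j := by
  classical
  have hzero := eq_zero_iff_of_rank_hadamard_eq hrank
  obtain ⟨r, s, hr, hs, h⟩ := exists_scaling_on_finset hrank (fun i j => mt (hzero i j).2)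
    (Finset.univ.filter fun p : I × J => M p.1 p.2 ≠ 0) (by simp)
  refine ⟨r, s, hr, hs, fun i j => ?_⟩
  by_cases hM : M i j = 0
  · rw [hM, (hzero i j).1 hM]
    simp
  · exact h i j (by simpa using hM)

end Hadamard

end MatrixTuples

namespace MatrixTuples

/-! ### Degrees of noncommutative polynomials -/

section Degree

variable {F : Type*} [Field F] {m : ℕ}

theorem ncDegree_le_iff {f : FreeAlgebra F (Fin m)} {d : ℕ} :
    ncDegree f ≤ d ↔
      ∀ w ∈ (FreeAlgebra.equivMonoidAlgebraFreeMonoid f).coeff.support, w.length ≤ d := by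
  rw [ncDegree, Finset.sup_le_iff]

theorem ncDegree_add_le {f g : FreeAlgebra F (Fin m)} {d : ℕ} (hf : ncDegree f ≤ d)
    (hg : ncDegree g ≤ d) : ncDegree (f + g) ≤ d := by
  classical
  rw [ncDegree_le_iff] at *
  intro w hw
  rw [map_add] at hw
  rcases Finset.mem_union.1 (Finsupp.support_add hw) with h | h
  exacts [hf w h, hg w h]

theorem ncDegree_mul_le {f g : FreeAlgebra F (Fin m)} {d e : ℕ} (hf : ncDegree f ≤ d)
    (hg : ncDegree g ≤ e) : ncDegree (f * g) ≤ d + e := by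
  classical
  rw [ncDegree_le_iff] at *
  intro w hw
  rw [map_mul] at hw
  obtain ⟨u, hu, v, hv, rfl⟩ := Finset.mem_mul.1 (MonoidAlgebra.support_coeff_mul_subset _ _ hw)
  rw [FreeMonoid.length_mul]
  exact add_le_add (hf u hu) (hg v hv)

theorem ncDegree_algebraMap (c : F) (d : ℕ) :
    ncDegree (algebraMap F (FreeAlgebra F (Fin m)) c) ≤ d := by
  rw [ncDegree_le_iff]
  intro w hw
  rw [AlgEquiv.commutes] at hw
  have := Finsupp.support_single_subset hw
  rw [Finset.mem_singleton] at this
  subst this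
  simp

theorem ncDegree_smul_le {f : FreeAlgebra F (Fin m)} {d : ℕ} (c : F) (hf : ncDegree f ≤ d) :
    ncDegree (c • f) ≤ d := by
  rw [Algebra.smul_def]
  simpa using ncDegree_mul_le (ncDegree_algebraMap c 0) hf

theorem ncDegree_ι (k : Fin m) : ncDegree (FreeAlgebra.ι F k) ≤ 1 := by
  rw [ncDegree_le_iff]
  intro w hw
  have h : FreeAlgebra.equivMonoidAlgebraFreeMonoid (FreeAlgebra.ι F k) =
      MonoidAlgebra.of F (FreeMonoid (Fin m)) (.of k) := by
    simp [FreeAlgebra.equivMonoidAlgebraFreeMonoid]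
  rw [h] at hw
  have := Finsupp.support_single_subset hw
  rw [Finset.mem_singleton] at this
  subst this
  simp

theorem ncDegree_sum_le {ι : Type*} (s : Finset ι) {f : ι → FreeAlgebra F (Fin m)} {d : ℕ}
    (hf : ∀ i ∈ s, ncDegree (f i) ≤ d) : ncDegree (∑ i ∈ s, f i) ≤ d := by
  classical
  induction s using Finset.induction_on with
  | empty => simpa using ncDegree_algebraMap (0 : F) d
  | insert a s ha ih =>
    rw [Finset.sum_insert ha]
    exact ncDegree_add_le (hf a (Finset.mem_insert_self _ _))
      (ih fun i hi => hf i (Finset.mem_insert_of_mem hi))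

theorem ncDegree_pow_le {f : FreeAlgebra F (Fin m)} {d : ℕ} (hf : ncDegree f ≤ d) (k : ℕ) :
    ncDegree (f ^ k) ≤ k * d := by
  induction k with
  | zero => simpa using ncDegree_algebraMap (1 : F) 0
  | succ k ih =>
    rw [pow_succ, Nat.succ_mul]
    exact ncDegree_mul_le ih hf

theorem ncDegree_aeval_ι_le (p : Polynomial F) (k : Fin m) :
    ncDegree (Polynomial.aeval (FreeAlgebra.ι F k) p) ≤ p.natDegree := by
  rw [Polynomial.aeval_eq_sum_range]
  refine ncDegree_sum_le _ fun i hi => ncDegree_smul_le _ ?_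
  have h₁ := ncDegree_pow_le (ncDegree_ι (F := F) k) i
  have h₂ := Finset.mem_range.1 hi
  omega

end Degree

/-! ### Conjugation, eigenvalues and diagonalisation -/

section Orbits

variable {F : Type*} [Field F] {n m : ℕ}

/-- Simultaneous conjugation of a tuple. -/
def conj (g : Matrix.GeneralLinearGroup (Fin n) F) (A : Tuple F n m) : Tuple F n m := fun k =>
  (g : Matrix (Fin n) (Fin n) F) * A k * ((g⁻¹ : Matrix.GeneralLinearGroup (Fin n) F) :
    Matrix (Fin n) (Fin n) F)

theorem conj_conj (g h : Matrix.GeneralLinearGroup (Fin n) F) (A : Tuple F n m) :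
    conj g (conj h A) = conj (g * h) A := by
  ext1 k
  simp only [conj, mul_inv_rev, Units.val_mul, mul_assoc]

theorem orbit_conj (g : Matrix.GeneralLinearGroup (Fin n) F) (A : Tuple F n m) :
    orbit (conj g A) = orbit A := by
  apply Set.Subset.antisymm
  · rintro _ ⟨h, rfl⟩
    exact ⟨h * g, (conj_conj h g A).symm⟩
  · rintro _ ⟨h, rfl⟩
    refine ⟨h * g⁻¹, ?_⟩
    change conj (h * g⁻¹) (conj g A) = conj h A
    rw [conj_conj, inv_mul_cancel_right]

theorem mem_orbit_self (A : Tuple F n m) : A ∈ orbit A :=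
  ⟨1, by ext1 k; simp⟩

theorem lift_conj (g : Matrix.GeneralLinearGroup (Fin n) F) (A : Tuple F n m)
    (f : FreeAlgebra F (Fin m)) :
    FreeAlgebra.lift F (conj g A) f =
      (g : Matrix (Fin n) (Fin n) F) * FreeAlgebra.lift F A f *
        ((g⁻¹ : Matrix.GeneralLinearGroup (Fin n) F) : Matrix (Fin n) (Fin n) F) := by
  induction f using FreeAlgebra.induction with
  | grade0 c =>
    rw [AlgHom.commutes, AlgHom.commutes, ← Algebra.commutes, mul_assoc, Units.mul_inv, mul_one]
  | grade1 k => simp only [FreeAlgebra.lift_ι_apply, conj]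
  | mul f₁ f₂ h₁ h₂ =>
    rw [map_mul, map_mul, h₁, h₂]
    simp only [mul_assoc, Units.inv_mul_cancel_left]
  | add f₁ f₂ h₁ h₂ => rw [map_add, map_add, h₁, h₂, mul_add, add_mul]

theorem rank_lift_conj (g : Matrix.GeneralLinearGroup (Fin n) F) (A : Tuple F n m)
    (f : FreeAlgebra F (Fin m)) :
    (FreeAlgebra.lift F (conj g A) f).rank = (FreeAlgebra.lift F A f).rank := by
  rw [lift_conj, Matrix.rank_mul_eq_left_of_isUnit_det, Matrix.rank_mul_eq_right_of_isUnit_det]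
  · exact (Matrix.isUnit_iff_isUnit_det _).1 g.isUnit
  · exact (Matrix.isUnit_iff_isUnit_det _).1 (g⁻¹).isUnit

theorem hasEigenvalue_iff_rank_ne {M : Matrix (Fin n) (Fin n) F} {μ : F} :
    Module.End.HasEigenvalue (Matrix.toLin' M) μ ↔
      (M - algebraMap F (Matrix (Fin n) (Fin n) F) μ).rank ≠ n := by
  have h₁ : Module.End.eigenspace (Matrix.toLin' M) μ =
      LinearMap.ker (M - algebraMap F (Matrix (Fin n) (Fin n) F) μ).mulVecLin := by
    ext w
    rw [Module.End.mem_eigenspace_iff, LinearMap.mem_ker, Matrix.mulVecLin_apply,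
      Matrix.sub_mulVec, Matrix.toLin'_apply, sub_eq_zero, Matrix.algebraMap_eq_diagonal]
    rw [show (Matrix.diagonal ((algebraMap F (Fin n → F)) μ)).mulVec w = μ • w from ?_]
    ext i
    simp [Matrix.mulVec_diagonal]
  have h₂ := LinearMap.finrank_range_add_finrank_ker
    (M - algebraMap F (Matrix (Fin n) (Fin n) F) μ).mulVecLin
  rw [Module.finrank_fin_fun] at h₂
  rw [Module.End.hasEigenvalue_iff, h₁, Ne, ← Submodule.finrank_eq_zero, Matrix.rank]
  omega

theorem exists_conj_eq_diagonal (A : Tuple F n 2) {a : Fin n → F} (ha : Function.Injective a)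
    (h : ∀ i, Module.End.HasEigenvalue (Matrix.toLin' (A 0)) (a i)) :
    ∃ g : Matrix.GeneralLinearGroup (Fin n) F, conj g A 0 = Matrix.diagonal a := by
  choose v hv using fun i => (h i).exists_hasEigenvector
  have hli := Module.End.eigenvectors_linearIndependent' (Matrix.toLin' (A 0)) a ha v hv
  let Q : Matrix (Fin n) (Fin n) F := Matrix.of fun i j => v j i
  have hQ : IsUnit Q := Matrix.linearIndependent_cols_iff_isUnit.1 hli
  obtain ⟨q, hq⟩ := hQ
  have hAQ : A 0 * Q = Q * Matrix.diagonal a := by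
    ext i j
    rw [Matrix.mul_diagonal]
    have := congrFun (hv j).apply_eq_smul i
    rw [Matrix.toLin'_apply] at this
    rw [Matrix.mul_apply]
    simpa [Matrix.mulVec, dotProduct, Q, mul_comm] using this
  refine ⟨q⁻¹, ?_⟩
  simp only [conj, inv_inv]
  rw [mul_assoc, hq, hAQ, ← hq, Units.inv_mul_cancel_left]

end Orbits

/-! ### Pairs with diagonal first matrix -/

section DiagonalPairs

variable {F : Type*} [Field F] {n : ℕ}

/-- The value at `X₁` of the `i`-th Lagrange basis polynomial with nodes `a`. -/
noncomputable def idempotent (a : Fin n → F) (i : Fin n) : FreeAlgebra F (Fin 2) :=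
  Polynomial.aeval (FreeAlgebra.ι F 0) (Lagrange.basis Finset.univ a i)

theorem ncDegree_idempotent {a : Fin n → F} (ha : Function.Injective a) (i : Fin n) :
    ncDegree (idempotent a i) ≤ n - 1 := by
  refine (ncDegree_aeval_ι_le _ _).trans ?_
  rw [Lagrange.natDegree_basis ha.injOn (Finset.mem_univ i), Finset.card_univ, Fintype.card_fin]

/-- A polynomial acts on `diag a` entrywise, and the Lagrange basis polynomial takes the value 1 at
`a i` and 0 at the other nodes. -/
theorem lift_idempotent {A : Tuple F n 2} {a : Fin n → F} (ha : Function.Injective a)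
    (hA : A 0 = Matrix.diagonal a) (i : Fin n) :
    FreeAlgebra.lift F A (idempotent a i) = Matrix.single i i 1 := by
  have h : Matrix.diagonal a = Matrix.diagonalAlgHom F a := rfl
  rw [idempotent, ← Polynomial.aeval_algHom_apply, FreeAlgebra.lift_ι_apply, hA, h,
    Polynomial.aeval_algHom_apply, Matrix.diagonalAlgHom_apply, ← Matrix.diagonal_single]
  congr 1
  ext j
  rw [Polynomial.aeval_fn_apply, Polynomial.coe_aeval_eq_eval]
  by_cases hij : i = j
  · subst hij
    rw [Lagrange.eval_basis_self ha.injOn (Finset.mem_univ i), Pi.single_eq_same]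
  · rw [Lagrange.eval_basis_of_ne hij (Finset.mem_univ j), Pi.single_eq_of_ne (Ne.symm hij)]

/-- A polynomial of degree at most `2n - 1` whose value at `(diag a, M)` is the Hadamard product
`C ⊙ M` plus `diag d`. -/
noncomputable def hadamardPoly (a : Fin n → F) (C : Matrix (Fin n) (Fin n) F) (d : Fin n → F) :
    FreeAlgebra F (Fin 2) :=
  ∑ i, ∑ j, C i j • (idempotent a i * FreeAlgebra.ι F 1 * idempotent a j) +
    ∑ i, d i • idempotent a i

theorem ncDegree_hadamardPoly {a : Fin n → F} (ha : Function.Injective a)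
    (C : Matrix (Fin n) (Fin n) F) (d : Fin n → F) :
    ncDegree (hadamardPoly a C d) ≤ 2 * n - 1 := by
  refine ncDegree_add_le (ncDegree_sum_le _ fun i _ => ncDegree_sum_le _ fun j _ =>
    ncDegree_smul_le _ ?_) (ncDegree_sum_le _ fun i _ => ncDegree_smul_le _ ?_)
  -- An index `i` gives `n ≥ 1`, so `(n - 1) + 1 + (n - 1) = 2n - 1` holds with truncated
  -- subtraction.
  · have hi := i.pos
    exact (ncDegree_mul_le (ncDegree_mul_le (ncDegree_idempotent ha i) (ncDegree_ι 1))
      (ncDegree_idempotent ha j)).trans (by omega)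
  · exact (ncDegree_idempotent ha i).trans (by omega)

theorem lift_hadamardPoly {A : Tuple F n 2} {a : Fin n → F} (ha : Function.Injective a)
    (hA : A 0 = Matrix.diagonal a) (C : Matrix (Fin n) (Fin n) F) (d : Fin n → F) :
    FreeAlgebra.lift F A (hadamardPoly a C d) = C.hadamard (A 1) + Matrix.diagonal d := by
  simp only [hadamardPoly, map_add, map_sum, map_smul, map_mul, lift_idempotent ha hA,
    FreeAlgebra.lift_ι_apply, Matrix.single_mul_mul_single, one_mul, mul_one, Matrix.smul_single,
    smul_eq_mul, Matrix.sum_single_eq_diagonal]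
  congr 1
  exact (Matrix.matrix_eq_sum_single (C.hadamard (A 1))).symm

theorem orbit_eq_of_rank_eq_of_diagonal {A B : Tuple F n 2} {a : Fin n → F}
    (ha : Function.Injective a) (hA : A 0 = Matrix.diagonal a) (hB : B 0 = Matrix.diagonal a)
    (hrank : ∀ f : FreeAlgebra F (Fin 2), ncDegree f ≤ 2 * n - 1 →
      (FreeAlgebra.lift F A f).rank = (FreeAlgebra.lift F B f).rank) :
    orbit A = orbit B := by
  have key : ∀ (C : Matrix (Fin n) (Fin n) F) (d : Fin n → F),
      (C.hadamard (A 1) + Matrix.diagonal d).rank =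
        (C.hadamard (B 1) + Matrix.diagonal d).rank := fun C d => by
    rw [← lift_hadamardPoly ha hA, ← lift_hadamardPoly ha hB]
    exact hrank _ (ncDegree_hadamardPoly ha C d)
  have hdiag : ∀ i, B 1 i i = A 1 i i := by
    intro i
    -- This test matrix has rank zero exactly when `M i i = A 1 i i`.
    have hval : ∀ M : Matrix (Fin n) (Fin n) F,
        (Matrix.single i i 1).hadamard M + Matrix.diagonal (Pi.single i (-A 1 i i)) =
          Matrix.single i i (M i i - A 1 i i) := by
      intro M
      rw [Matrix.diagonal_single, sub_eq_add_neg, Matrix.single_add]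
      congr 1
      ext x y
      by_cases h : i = x ∧ i = y
      · obtain ⟨rfl, rfl⟩ := h
        simp
      · simp [Matrix.single_apply_of_ne _ _ _ _ _ h]
    have h := key (Matrix.single i i 1) (Pi.single i (-A 1 i i))
    rw [hval, hval, sub_self, Matrix.single_zero, Matrix.rank_zero, eq_comm,
      rank_eq_zero_iff] at h
    exact sub_eq_zero.1 (by simpa using congrFun (congrFun h i) i)
  -- Diagonal entries of `A 1` may vanish and then say nothing about `r i * s i`; ones in their
  -- place force `r i * s i = 1`. The free term `diag d` supplies the diagonal of `C ⊙ unitDiag M`.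
  let unitDiag : Matrix (Fin n) (Fin n) F → Matrix (Fin n) (Fin n) F :=
    fun M => Matrix.of fun i j => if i = j then 1 else M i j
  have hunit : ∀ C M : Matrix (Fin n) (Fin n) F, C.hadamard (unitDiag M) =
      (Matrix.of fun i j => if i = j then 0 else C i j).hadamard M +
        Matrix.diagonal fun i => C i i := by
    intro C M
    ext i j
    by_cases h : i = j
    · subst h
      simp [unitDiag]
    · simp [unitDiag, h]
  obtain ⟨r, s, hr, hs, hrs⟩ := exists_scaling_of_rank_hadamard_eq
    (M := unitDiag (A 1)) (N := unitDiag (B 1)) fun C => by rw [hunit, hunit, key]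
  have hrs₁ : ∀ i, r i * s i = 1 := fun i => by simpa [unitDiag] using (hrs i i).symm
  have hentry : ∀ i j, B 1 i j = r i * A 1 i j * s j := by
    intro i j
    by_cases h : i = j
    · subst h
      rw [hdiag, mul_right_comm, hrs₁, one_mul]
    · simpa [unitDiag, h] using hrs i j
  let g : Matrix.GeneralLinearGroup (Fin n) F :=
    ⟨Matrix.diagonal r, Matrix.diagonal s, by simp [hrs₁], by simp [mul_comm (s _), hrs₁]⟩
  have hg : conj g A = B := by
    ext k i j
    change (Matrix.diagonal r * A k * Matrix.diagonal s) i j = B k i j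
    rw [Matrix.mul_diagonal, Matrix.diagonal_mul]
    fin_cases k
    · simp only [Fin.zero_eta, hA, hB]
      by_cases h : i = j
      · subst h
        rw [mul_right_comm, hrs₁, one_mul]
      · simp [Matrix.diagonal_apply_ne _ h]
    · exact (hentry i j).symm
  rw [← hg, orbit_conj]

/-- On `D_n` the ranks of noncommutative polynomials of degree at most `2n - 1` separate orbits. -/
theorem orbit_eq_of_rank_eq {A B : Tuple F n 2} (hA : A ∈ simpleSpectrumPairs F n)
    (hrank : ∀ f : FreeAlgebra F (Fin 2), ncDegree f ≤ 2 * n - 1 →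
      (FreeAlgebra.lift F A f).rank = (FreeAlgebra.lift F B f).rank) :
    orbit A = orbit B := by
  obtain ⟨a, ha, hAa⟩ := hA
  have hBa : ∀ i, Module.End.HasEigenvalue (Matrix.toLin' (B 0)) (a i) := by
    intro i
    have hi := i.pos
    -- The rank of `X₁ - a i` is below `n` exactly when `a i` is an eigenvalue.
    have h := hrank (FreeAlgebra.ι F 0 + algebraMap F _ (-a i))
      (ncDegree_add_le ((ncDegree_ι 0).trans (by omega)) (ncDegree_algebraMap _ _))
    rw [map_neg, ← sub_eq_add_neg, map_sub, map_sub, AlgHom.commutes, AlgHom.commutes,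
      FreeAlgebra.lift_ι_apply, FreeAlgebra.lift_ι_apply] at h
    rw [hasEigenvalue_iff_rank_ne, ← h, ← hasEigenvalue_iff_rank_ne]
    exact hAa i
  obtain ⟨g, hg⟩ := exists_conj_eq_diagonal A ha hAa
  obtain ⟨h, hh⟩ := exists_conj_eq_diagonal B ha hBa
  rw [← orbit_conj g A, ← orbit_conj h B]
  refine orbit_eq_of_rank_eq_of_diagonal ha hg hh fun f hf => ?_
  rw [rank_lift_conj, rank_lift_conj]
  exact hrank f hf

end DiagonalPairs

/-! ### From noncommutative polynomials to generic matrices -/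

section GenericMatrices

variable {F : Type*} [Field F] {n m : ℕ}

theorem map_lift_genericMatrix (A : Tuple F n m) (f : FreeAlgebra F (Fin m)) :
    (FreeAlgebra.lift F (genericMatrix F n m) f).map
      (MvPolynomial.eval fun x => A x.1 x.2.1 x.2.2) = FreeAlgebra.lift F A f := by
  have h : (MvPolynomial.aeval fun x : Fin m × Fin n × Fin n => A x.1 x.2.1 x.2.2).mapMatrix.comp
      (FreeAlgebra.lift F (genericMatrix F n m)) = FreeAlgebra.lift F A := by
    ext k i j
    simp [genericMatrix]
  rw [← h]
  rfl

theorem genericDegree_le_ncDegree {P : genericAlgebra F n m} {f : FreeAlgebra F (Fin m)}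
    (hf : FreeAlgebra.lift F (genericMatrix F n m) f = P) : genericDegree P ≤ ncDegree f :=
  Nat.sInf_le ⟨f, hf, rfl⟩

theorem rank_lift_mem_rankFunctions (f : FreeAlgebra F (Fin m)) {d : ℕ} (hf : ncDegree f ≤ d) :
    (fun A : Tuple F n m => (FreeAlgebra.lift F A f).rank) ∈ rankFunctions F n m d := by
  have hmem : FreeAlgebra.lift F (genericMatrix F n m) f ∈ genericAlgebra F n m := by
    rw [genericAlgebra, Algebra.adjoin_range_eq_range_freeAlgebra_lift]
    exact ⟨f, rfl⟩
  refine ⟨⟨_, hmem⟩, ?_, ?_⟩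
  · exact (genericDegree_le_ncDegree (P := ⟨_, hmem⟩) rfl).trans hf
  · ext A
    rw [evalAt, map_lift_genericMatrix]

end GenericMatrices

end MatrixTuples

theorem mainTheorem1 (F : Type*) [Field F] (n : ℕ) (hn : 2 ≤ n) :
    MatrixTuples.SeparatesOrbitsOn (MatrixTuples.simpleSpectrumPairs F n)
        (MatrixTuples.rankFunctions F n 2 ((n + 1) * (2 * n - 1))) ∧
      ∀ A ∈ MatrixTuples.simpleSpectrumPairs F n, ∀ B ∈ MatrixTuples.simpleSpectrumPairs F n,
        (MatrixTuples.orbit A = MatrixTuples.orbit B ↔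
          ∀ f : FreeAlgebra F (Fin 2),
            (FreeAlgebra.lift F A f).rank = (FreeAlgebra.lift F B f).rank) := by
  refine ⟨fun A hA B _ hrank => ?_, fun A hA B _ => ⟨fun h f => ?_, fun h => ?_⟩⟩
  · refine MatrixTuples.orbit_eq_of_rank_eq hA fun f hf => ?_
    -- Degree `2n - 1` already suffices; the stated bound is a positive multiple of it.
    exact hrank _ (MatrixTuples.rank_lift_mem_rankFunctions f
      (hf.trans (Nat.le_mul_of_pos_left _ n.succ_pos)))
  · obtain ⟨g, rfl⟩ : B ∈ MatrixTuples.orbit A := h ▸ MatrixTuples.mem_orbit_self B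
    exact (MatrixTuples.rank_lift_conj g A f).symm
  · exact MatrixTuples.orbit_eq_of_rank_eq hA fun f _ => h f
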